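/- Fix a computable bijection $\langle\cdot,\cdot\rangle:\mathbb N\times\mathbb N\to\mathbb N$. For $F\subseteq\mathbb N$ and $n\in\mathbb N$ let $F_n=\{x\in\mathbb N : \langle x,n\rangle\in F\}$ be the $n$-th column of $F$, and write $A\subseteq^* B$ if $A\setminus B$ is finite. Then there is a co-c.e. set $F\subseteq\mathbb N$ (that is, $\mathbb N\setminus F$ is computably enumerable) such that 1. every column $F_n$ is an infinite computable set; 2. $F$ is a tower: for every $n$, $F_{n+1}\subseteq^* F_n$ and $F_n\setminus F_{n+1}$ is infinite; 3. $F$ is an ultrafilter base within the computable sets: for every computable set $R\subseteq\mathbb N$ there is an $n$ such that $F_n\subseteq^* R$ or $F_n\subseteq^*\mathbb N\setminus R$. -/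

import Mathlib

/-- The `n`-th column `{x : ⟨x, n⟩ ∈ F}` of a set of natural numbers, with respect to the
computable pairing bijection `Nat.pair`. -/
def column (F : Set ℕ) (n : ℕ) : Set ℕ := {x | Nat.pair x n ∈ F}

/-- Almost inclusion. -/
def AlmostSubset (A B : Set ℕ) : Prop := (A \ B).Finite

/-- A computable (recursive) set of natural numbers. -/
def IsComputableSet (A : Set ℕ) : Prop := ComputablePred (fun x => x ∈ A)

/-- A set of natural numbers with computably enumerable complement. -/
def IsCoCE (A : Set ℕ) : Prop := REPred (fun x => x ∉ A)

/-- `F` encodes, through its columns, a class of infinite computable sets. -/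
def EncodesClass (F : Set ℕ) : Prop :=
  ∀ n, (column F n).Infinite ∧ IsComputableSet (column F n)

/-- `F` is a tower: the columns are infinite computable sets, and each is almost contained in the
previous one, with infinite difference. -/
def IsTower (F : Set ℕ) : Prop :=
  EncodesClass F ∧
    ∀ n, AlmostSubset (column F (n + 1)) (column F n) ∧
      (column F n \ column F (n + 1)).Infinite

/-- `F` is an ultrafilter base within the computable sets: it is a tower, and for every computable
set `R` some column is almost contained in `R` or in its complement. -/
def IsUltrafilterBase (F : Set ℕ) : Prop :=
  IsTower F ∧
    ∀ R : Set ℕ, IsComputableSet R →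
      ∃ n, AlmostSubset (column F n) Rᶜ ∨ AlmostSubset (column F n) R

/-! This is an e-state construction, as for a maximal set. Every number carries a string of symbols
that only climbs lexicographically, and a number of rank r is killed when a larger alive number has
a larger state on r symbols. Infinitely many numbers stay alive (`exists_permanent_ge`), and from
some point on these share a final value σ of the first e symbols (`exists_isLimit`).

Level e asks each number to agree, at every stage, with the next alive number on e symbols. This is
co-c.e. uniformly in e. Beyond a finite part it is equivalent to reaching σ at some late stage
(`IsLimit.mem_level_iff`), which is c.e.; hence each level is computable, though not uniformly.

Symbol i becomes 2 or 3 once the i-th partial function is seen to return 0 or 1, so level i + 1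
decides every computable set with index i. It must first pass from 0 to 1, which needs a smaller
witness still showing 0. The rank condition on witnesses makes the least one lose the comparison and
die with symbol 0 (`IsLimit.exists_killed`). Such corpses lie in level i but not in level i + 1,
making the tower strict. -/

namespace TowerConstruction

/-! ### The construction: states, configurations and stages -/

/-- The `i`-th symbol (in `{0, 1, 2, 3}`) of a state, a finite list padded by zeros. -/
def sym (l : List ℕ) (i : ℕ) : ℕ := min (l.getD i 0) 3

/-- The number with base-4 digits the first `e` symbols of a state; comparing these numbers
amounts to comparing the strings of symbols lexicographically. -/
def val (l : List ℕ) (e : ℕ) : ℕ := Nat.rec 0 (fun i v => 4 * v + sym l i) e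

/-- Set the `i`-th symbol of a state to `v` and all later ones to `0`. -/
def setSym (l : List ℕ) (i v : ℕ) : List ℕ := (List.range i).map (sym l) ++ [v]

/-- A configuration assigns to each number whether it is alive, and a state. Numbers
beyond the length of the list are alive and have the empty state. -/
abbrev Config := List (Bool × List ℕ)

def Alive (C : Config) (x : ℕ) : Prop := (C.getD x (true, [])).1 = true

def stateOf (C : Config) (x : ℕ) : List ℕ := (C.getD x (true, [])).2

instance (C : Config) : DecidablePred (Alive C) := fun _ => inferInstanceAs (Decidable (_ = _))

/-- The number of alive numbers below `x`. -/
def rank (C : Config) (x : ℕ) : ℕ := Nat.count (Alive C) x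

/-- Some alive `z < x` of rank above `i` agrees with `x` on the first `i` symbols and has
`i`-th symbol `0`. -/
def HasWitness (C : Config) (i x : ℕ) : Prop :=
  ∃ z < x, Alive C z ∧ val (stateOf C z) i = val (stateOf C x) i ∧ sym (stateOf C z) i = 0 ∧
    i < rank C z

/-- The bounded computation, with bound `s`, of the `i`-th partial computable function. -/
def run (s i x : ℕ) : Option ℕ := (Denumerable.ofNat Nat.Partrec.Code i).evaln s x

open Classical in
/-- The state of `x` after stage `s`, which treats the symbol with index `s.unpair.1`. -/
noncomputable def newState (C : Config) (s x : ℕ) : List ℕ :=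
  if Alive C x ∧ sym (stateOf C x) s.unpair.1 = 0 ∧ HasWitness C s.unpair.1 x then
    setSym (stateOf C x) s.unpair.1 1
  else if Alive C x ∧ sym (stateOf C x) s.unpair.1 = 1 ∧ run s s.unpair.1 x = some 0 then
    setSym (stateOf C x) s.unpair.1 2
  else if Alive C x ∧ sym (stateOf C x) s.unpair.1 = 1 ∧ run s s.unpair.1 x = some 1 then
    setSym (stateOf C x) s.unpair.1 3
  else stateOf C x

/-- At stage `s`, an alive number survives if no larger alive number up to `s` has a larger state,
where the rank of the number tells how many symbols are compared. -/
def Survives (C : Config) (s x : ℕ) : Prop :=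
  Alive C x ∧ ¬ ∃ y < s + 1, x < y ∧ Alive C y ∧
    val (newState C s x) (rank C x) < val (newState C s y) (rank C x)

-- States and survival are computed simultaneously from the previous configuration: survival
-- compares new states but uses old ranks. Every index is treated at infinitely many stages, since
-- `s.unpair.1` takes each value infinitely often.
open Classical in
noncomputable def conf (s : ℕ) : Config :=
  Nat.rec [] (fun s C => (List.range (s + 1)).map fun x =>
    (decide (Survives C s x), newState C s x)) s

/-! ### The construction is primitive recursive -/

open Primrec

theorem primrec_sym : Primrec₂ sym :=
  nat_min.comp₂ (list_getD 0) (Primrec₂.const 3)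

theorem primrec_val : Primrec₂ val :=
  nat_rec' (f := fun p : List ℕ × ℕ => p.2) snd (const 0)
    (nat_add.comp (nat_mul.comp (const 4) (snd.comp snd))
      (primrec_sym.comp (fst.comp fst) (fst.comp snd))).to₂

theorem primrec_setSym : Primrec fun p : List ℕ × ℕ × ℕ => setSym p.1 p.2.1 p.2.2 :=
  list_append.comp
    (list_map (list_range.comp (fst.comp snd)) (primrec_sym.comp (fst.comp fst) snd).to₂)
    (list_cons.comp (snd.comp snd) (const []))

theorem primrecRel_alive : PrimrecRel Alive :=
  Primrec.eq.comp (fst.comp (list_getD (true, ([] : List ℕ)))) (const true)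

theorem primrec_stateOf : Primrec₂ stateOf :=
  snd.comp (list_getD (true, ([] : List ℕ)))

theorem primrec_rank : Primrec₂ rank := by
  have h : Primrec fun p : Config × ℕ =>
      (Nat.rec 0 (fun z k => if Alive p.1 z then k + 1 else k) p.2 : ℕ) :=
    nat_rec' (f := fun p : Config × ℕ => p.2) snd (const 0)
      (Primrec.ite (primrecRel_alive.comp (fst.comp fst) (fst.comp snd))
        (Primrec.succ.comp (snd.comp snd)) (snd.comp snd)).to₂
  refine h.of_eq fun p => ?_
  induction p.2 with
  | zero => simp [rank]
  | succ n ih =>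
    simp only [rank, Nat.count_succ] at ih ⊢
    rw [ih]
    split_ifs <;> rfl

theorem primrec_run : Primrec fun p : ℕ × ℕ × ℕ => run p.1 p.2.1 p.2.2 :=
  Nat.Partrec.Code.primrec_evaln.comp
    ((fst.pair ((Primrec.ofNat _).comp (fst.comp snd))).pair (snd.comp snd))

/-- Bounded existential quantification with a primitive recursive bound. -/
theorem primrecPred_exists_lt {α : Type*} [Primcodable α] {f : α → ℕ} {R : α → ℕ → Prop}
    (hf : Primrec f) (hR : PrimrecRel R) : PrimrecPred fun a => ∃ x < f a, R a x :=
  ((PrimrecRel.exists_mem_list hR.swap).comp (list_range.comp hf) Primrec.id).of_eq fun a => by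
    simp [Function.swap]

theorem primrecPred_forall_lt {α : Type*} [Primcodable α] {f : α → ℕ} {R : α → ℕ → Prop}
    (hf : Primrec f) (hR : PrimrecRel R) : PrimrecPred fun a => ∀ x < f a, R a x :=
  ((PrimrecRel.forall_mem_list hR.swap).comp (list_range.comp hf) Primrec.id).of_eq fun a => by
    simp [Function.swap]

theorem primrecPred_hasWitness :
    PrimrecPred fun p : Config × ℕ × ℕ => HasWitness p.1 p.2.1 p.2.2 := by
  have hC : Primrec fun q : (Config × ℕ × ℕ) × ℕ => q.1.1 := fst.comp fst
  have hi : Primrec fun q : (Config × ℕ × ℕ) × ℕ => q.1.2.1 := fst.comp (snd.comp fst)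
  have hx : Primrec fun q : (Config × ℕ × ℕ) × ℕ => q.1.2.2 := snd.comp (snd.comp fst)
  have hz : Primrec fun q : (Config × ℕ × ℕ) × ℕ => q.2 := snd
  have hsz := primrec_stateOf.comp hC hz
  refine primrecPred_exists_lt (snd.comp snd) ?_
  exact (primrecRel_alive.comp hC hz).and
    ((Primrec.eq.comp (primrec_val.comp hsz hi)
      (primrec_val.comp (primrec_stateOf.comp hC hx) hi)).and
    ((Primrec.eq.comp (primrec_sym.comp hsz hi) (const 0)).and
      (nat_lt.comp hi (primrec_rank.comp hC hz))))

theorem primrec_newState :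
    Primrec fun p : Config × ℕ × ℕ => newState p.1 p.2.1 p.2.2 := by
  have hC : Primrec fun p : Config × ℕ × ℕ => p.1 := fst
  have hs : Primrec fun p : Config × ℕ × ℕ => p.2.1 := fst.comp snd
  have hi : Primrec fun p : Config × ℕ × ℕ => p.2.1.unpair.1 := fst.comp (unpair.comp hs)
  have hx : Primrec fun p : Config × ℕ × ℕ => p.2.2 := snd.comp snd
  have hl := primrec_stateOf.comp hC hx
  have ha := primrecRel_alive.comp hC hx
  have hy := primrec_sym.comp hl hi
  have hr := primrec_run.comp (hs.pair (hi.pair hx))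
  have hset (v : ℕ) := primrec_setSym.comp (hl.pair (hi.pair (const v)))
  classical
  exact Primrec.ite (ha.and ((Primrec.eq.comp hy (const 0)).and
      (primrecPred_hasWitness.comp (hC.pair (hi.pair hx))))) (hset 1)
    (Primrec.ite (ha.and ((Primrec.eq.comp hy (const 1)).and (Primrec.eq.comp hr (const _))))
      (hset 2)
      (Primrec.ite (ha.and ((Primrec.eq.comp hy (const 1)).and (Primrec.eq.comp hr (const _))))
        (hset 3) hl))

theorem primrecPred_survives :
    PrimrecPred fun p : Config × ℕ × ℕ => Survives p.1 p.2.1 p.2.2 := by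
  have hC : Primrec fun q : (Config × ℕ × ℕ) × ℕ => q.1.1 := fst.comp fst
  have hs : Primrec fun q : (Config × ℕ × ℕ) × ℕ => q.1.2.1 := fst.comp (snd.comp fst)
  have hx : Primrec fun q : (Config × ℕ × ℕ) × ℕ => q.1.2.2 := snd.comp (snd.comp fst)
  have hy : Primrec fun q : (Config × ℕ × ℕ) × ℕ => q.2 := snd
  have hr := primrec_rank.comp hC hx
  refine (primrecRel_alive.comp fst (snd.comp snd)).and (PrimrecPred.not
    (primrecPred_exists_lt (Primrec.succ.comp (fst.comp snd)) ?_))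
  exact (nat_lt.comp hx hy).and ((primrecRel_alive.comp hC hy).and
    (nat_lt.comp (primrec_val.comp (primrec_newState.comp (hC.pair (hs.pair hx))) hr)
      (primrec_val.comp (primrec_newState.comp (hC.pair (hs.pair hy))) hr)))

theorem primrec_config : Primrec conf := by
  classical
  refine nat_rec₁ _
    (list_map (list_range.comp (Primrec.succ.comp fst)) (Primrec₂.mk (Primrec.pair ?_ ?_)))
  · exact PrimrecPred.decide (primrecPred_survives.comp
      ((snd.comp fst).pair ((fst.comp fst).pair snd)))
  · exact primrec_newState.comp ((snd.comp fst).pair ((fst.comp fst).pair snd))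

/-! ### Enumerability -/

theorem rePred_exists {α : Type*} [Primcodable α] {R : α → ℕ → Prop} (hR : PrimrecRel R) :
    REPred fun a => ∃ n, R a n := by
  classical
  have h : Partrec fun a => Nat.rfind fun n => Part.some (decide (R a n)) :=
    Partrec.rfind (PrimrecRel.decide hR).to_comp.partrec₂
  refine h.dom_re.of_eq fun a => ?_
  exact Nat.rfind_dom'.trans (by simp)

/-! ### States -/

theorem sym_le (l : List ℕ) (i : ℕ) : sym l i ≤ 3 := min_le_right _ _

theorem val_zero (l : List ℕ) : val l 0 = 0 := rfl

theorem val_succ (l : List ℕ) (e : ℕ) : val l (e + 1) = 4 * val l e + sym l e := rfl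

theorem val_nil (e : ℕ) : val [] e = 0 := by
  induction e with
  | zero => rfl
  | succ e ih => rw [val_succ, ih]; simp [sym]

theorem val_lt_pow (l : List ℕ) (e : ℕ) : val l e < 4 ^ e := by
  induction e with
  | zero => simp [val_zero]
  | succ e ih => have := sym_le l e; rw [val_succ, pow_succ]; omega

theorem val_lt_val_of_le {l l' : List ℕ} {e r : ℕ} (her : e ≤ r) (h : val l e < val l' e) :
    val l r < val l' r := by
  induction r, her using Nat.le_induction with
  | base => exact h
  | succ r _ ih => have := sym_le l r; rw [val_succ, val_succ]; omega

theorem val_le_val_of_le {l l' : List ℕ} {e r : ℕ} (her : e ≤ r) (h : val l r ≤ val l' r) :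
    val l e ≤ val l' e := by
  by_contra! h'
  exact absurd (val_lt_val_of_le her h') (by omega)

theorem sym_setSym_of_lt (l : List ℕ) {i j : ℕ} (v : ℕ) (h : j < i) :
    sym (setSym l i v) j = sym l j := by
  have : j < ((List.range i).map (sym l)).length := by simpa using h
  rw [sym, setSym, List.getD_append _ _ _ _ this, List.getD_eq_getElem _ _ this]
  simp [sym]

theorem sym_setSym_self (l : List ℕ) (i : ℕ) {v : ℕ} (hv : v ≤ 3) :
    sym (setSym l i v) i = v := by
  simp [sym, setSym, hv]

theorem sym_setSym_of_gt (l : List ℕ) {i j : ℕ} (v : ℕ) (h : i < j) :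
    sym (setSym l i v) j = 0 := by
  unfold sym setSym
  rw [List.getD_eq_default _ _ (by simp; omega)]
  rfl

theorem val_setSym_of_le (l : List ℕ) {i e : ℕ} (v : ℕ) (h : e ≤ i) :
    val (setSym l i v) e = val l e := by
  induction e with
  | zero => rfl
  | succ e ih => rw [val_succ, val_succ, ih (by omega), sym_setSym_of_lt _ _ (by omega)]

/-- Raising one digit outweighs resetting all later digits to 0. -/
theorem val_le_val_setSym {l : List ℕ} {i v : ℕ} (h : sym l i < v) (hv : v ≤ 3) (e : ℕ) :
    val l e ≤ val (setSym l i v) e := by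
  rcases le_or_gt e i with he | he
  · rw [val_setSym_of_le _ _ he]
  · refine (val_lt_val_of_le (Nat.succ_le_of_lt he) ?_).le
    rw [Nat.succ_eq_add_one, val_succ, val_succ, val_setSym_of_le _ _ le_rfl,
      sym_setSym_self _ _ hv]
    omega

/-! ### One stage -/

/-- What may happen to a state during stage `s`. -/
theorem newState_cases (C : Config) (s x : ℕ) :
    newState C s x = stateOf C x ∨ Alive C x ∧
      ((sym (stateOf C x) s.unpair.1 = 0 ∧ HasWitness C s.unpair.1 x ∧
          newState C s x = setSym (stateOf C x) s.unpair.1 1) ∨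
        ∃ v ≤ 1, sym (stateOf C x) s.unpair.1 = 1 ∧ run s s.unpair.1 x = some v ∧
          newState C s x = setSym (stateOf C x) s.unpair.1 (v + 2)) := by
  unfold newState
  split_ifs with h₁ h₂ h₃
  · exact Or.inr ⟨h₁.1, Or.inl ⟨h₁.2.1, h₁.2.2, rfl⟩⟩
  · exact Or.inr ⟨h₂.1, Or.inr ⟨0, by omega, h₂.2.1, h₂.2.2, rfl⟩⟩
  · exact Or.inr ⟨h₃.1, Or.inr ⟨1, by omega, h₃.2.1, h₃.2.2, rfl⟩⟩
  · exact Or.inl rfl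

theorem newState_of_not_alive {C : Config} {s x : ℕ} (h : ¬ Alive C x) :
    newState C s x = stateOf C x := by
  simp [newState, h]

theorem val_le_val_newState (C : Config) (s x e : ℕ) :
    val (stateOf C x) e ≤ val (newState C s x) e := by
  rcases newState_cases C s x with h | ⟨-, ⟨h₀, -, h⟩ | ⟨v, hv, h₁, -, h⟩⟩
  · rw [h]
  · rw [h]; exact val_le_val_setSym (by omega) (by omega) e
  · rw [h]; exact val_le_val_setSym (by omega) (by omega) e

theorem config_succ_getD {s x : ℕ} (h : x ≤ s) :
    (conf (s + 1)).getD x (true, []) =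
      (@decide (Survives (conf s) s x) (Classical.propDecidable _), newState (conf s) s x) := by
  classical
  have hlt : x < ((List.range (s + 1)).map fun x =>
      (@decide (Survives (conf s) s x) (Classical.propDecidable _),
        newState (conf s) s x)).length := by simpa using Nat.lt_succ_of_le h
  exact (List.getD_eq_getElem _ _ hlt).trans (by
    rw [List.getElem_map]
    simp only [List.getElem_range])

theorem alive_succ_iff {s x : ℕ} (h : x ≤ s) :
    Alive (conf (s + 1)) x ↔ Survives (conf s) s x := by
  rw [Alive, config_succ_getD h]; simp

theorem stateOf_succ {s x : ℕ} (h : x ≤ s) :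
    stateOf (conf (s + 1)) x = newState (conf s) s x := by
  rw [stateOf, config_succ_getD h]

theorem length_config (s : ℕ) : (conf s).length = s := by
  cases s <;> simp [conf]

theorem alive_of_le {s x : ℕ} (h : s ≤ x) : Alive (conf s) x := by
  rw [Alive, List.getD_eq_default _ _ (by rw [length_config]; exact h)]

theorem stateOf_of_le {s x : ℕ} (h : s ≤ x) : stateOf (conf s) x = [] := by
  rw [stateOf, List.getD_eq_default _ _ (by rw [length_config]; exact h)]

theorem alive_of_alive_succ {s x : ℕ} (h : Alive (conf (s + 1)) x) : Alive (conf s) x := by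
  rcases le_or_gt x s with hx | hx
  · exact ((alive_succ_iff hx).1 h).1
  · exact alive_of_le hx.le

/-- The value, at stage `s`, of the first `e` symbols of `x`. -/
noncomputable def stageVal (s x e : ℕ) : ℕ := val (stateOf (conf s) x) e

theorem stageVal_le_succ (s x e : ℕ) : stageVal s x e ≤ stageVal (s + 1) x e := by
  rcases le_or_gt x s with hx | hx
  · rw [stageVal, stageVal, stateOf_succ hx]; exact val_le_val_newState _ _ _ _
  · rw [stageVal, stateOf_of_le hx.le, val_nil]; exact Nat.zero_le _

theorem stageVal_mono (x e : ℕ) : Monotone fun s => stageVal s x e :=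
  monotone_nat_of_le_succ fun s => stageVal_le_succ s x e

theorem stageVal_of_le {s x : ℕ} (h : s ≤ x) (e : ℕ) : stageVal s x e = 0 := by
  rw [stageVal, stateOf_of_le h, val_nil]

theorem stageVal_lt_pow (s x e : ℕ) : stageVal s x e < 4 ^ e := val_lt_pow _ _

theorem alive_anti {s t x : ℕ} (hst : s ≤ t) (h : Alive (conf t) x) : Alive (conf s) x := by
  induction t, hst using Nat.le_induction with
  | base => exact h
  | succ t _ ih => exact ih (alive_of_alive_succ h)

/-- Every clause changing a state requires the number to be alive, so the dead are frozen. -/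
theorem stateOf_eq_of_not_alive {s t x : ℕ} (hst : s ≤ t) (h : ¬ Alive (conf s) x) :
    stateOf (conf t) x = stateOf (conf s) x := by
  have hx : x < s := by by_contra! hx; exact h (alive_of_le hx)
  induction t, hst using Nat.le_induction with
  | base => rfl
  | succ t hst ih =>
    rw [stateOf_succ (by omega), newState_of_not_alive (fun h' => h (alive_anti hst h')), ih]

theorem stageVal_eq_of_not_alive {s t x : ℕ} (hst : s ≤ t) (h : ¬ Alive (conf s) x) (e : ℕ) :
    stageVal t x e = stageVal s x e := by
  rw [stageVal, stageVal, stateOf_eq_of_not_alive hst h]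

theorem rank_mono (C : Config) : Monotone (rank C) := Nat.count_monotone _

theorem rank_anti {s t : ℕ} (hst : s ≤ t) (x : ℕ) : rank (conf t) x ≤ rank (conf s) x :=
  Nat.count_mono_left fun _ _ h => alive_anti hst h

/-- Alive numbers are sorted by their states. -/
theorem stageVal_le_of_alive {s z y e : ℕ} (hz : Alive (conf s) z) (hy : Alive (conf s) y)
    (hzy : z ≤ y) (he : e ≤ rank (conf s) z) : stageVal s y e ≤ stageVal s z e := by
  rcases hzy.eq_or_lt with rfl | hzy
  · rfl
  rcases le_or_gt s y with hys | hys
  · rw [stageVal_of_le hys]; exact Nat.zero_le _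
  obtain ⟨s, rfl⟩ : ∃ t, s = t + 1 := ⟨s - 1, by omega⟩
  have h := (alive_succ_iff (by omega)).1 hz
  have her : e ≤ rank (conf s) z := he.trans (rank_anti (by omega) z)
  by_contra! hlt
  refine h.2 ⟨y, hys, hzy, alive_of_alive_succ hy, ?_⟩
  rw [← stateOf_succ (by omega), ← stateOf_succ (by omega)]
  exact val_lt_val_of_le her hlt

/-- A number can only be killed in favour of a larger one with at least the same state. -/
theorem exists_alive_succ {s x e : ℕ} (hx : Alive (conf s) x) (he : e ≤ rank (conf s) x) :
    ∃ y ≥ x, Alive (conf (s + 1)) y ∧ stageVal (s + 1) x e ≤ stageVal (s + 1) y e := by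
  -- The killer may itself be killed at this stage, so follow the chain of killers; it is increasing
  -- and bounded by s.
  induction hn : s + 1 - x using Nat.strong_induction_on generalizing x with
  | _ n ih =>
    by_cases h : Alive (conf (s + 1)) x
    · exact ⟨x, le_rfl, h, le_rfl⟩
    have hxs : x ≤ s := by by_contra! hxs; exact h (alive_of_le hxs)
    rw [alive_succ_iff hxs, Survives, not_and, not_not] at h
    obtain ⟨y, hys, hxy, hy, hlt⟩ := h hx
    rw [← stateOf_succ hxs, ← stateOf_succ (by omega)] at hlt
    obtain ⟨w, hw, hwa, hwv⟩ := ih (s + 1 - y) (by omega) hy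
      (he.trans (rank_mono _ hxy.le)) rfl
    exact ⟨w, by omega, hwa, (val_le_val_of_le he hlt.le).trans hwv⟩

/-! ### The numbers that stay alive -/

/-- `x` is alive at all stages. -/
def Permanent (x : ℕ) : Prop := ∀ s, Alive (conf s) x

theorem exists_settled (b : ℕ) :
    ∃ s₀, ∀ x < b, Permanent x ∨ ¬ Alive (conf s₀) x := by
  induction b with
  | zero => exact ⟨0, fun x hx => absurd hx (by omega)⟩
  | succ b ih =>
    obtain ⟨s₀, hs₀⟩ := ih
    by_cases h : Permanent b
    · exact ⟨s₀, fun x hx => (Nat.lt_succ_iff_lt_or_eq.1 hx).elim (hs₀ x) fun h' => Or.inl (h' ▸ h)⟩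
    · obtain ⟨t, ht⟩ := not_forall.1 h
      refine ⟨max s₀ t, fun x hx => ?_⟩
      rcases Nat.lt_succ_iff_lt_or_eq.1 hx with hx | rfl
      · exact (hs₀ x hx).imp_right fun h' halive => h' (alive_anti (le_max_left _ _) halive)
      · exact Or.inr fun halive => ht (alive_anti (le_max_right _ _) halive)

/-- The first alive number from `b` on. -/
theorem exists_next (s b : ℕ) :
    ∃ y ≥ b, Alive (conf s) y ∧ ∀ z, b ≤ z → z < y → ¬ Alive (conf s) z := by
  classical
  have h : ∃ y, b ≤ y ∧ Alive (conf s) y :=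
    ⟨max b s, le_max_left _ _, alive_of_le (le_max_right _ _)⟩
  exact ⟨Nat.find h, (Nat.find_spec h).1, (Nat.find_spec h).2,
    fun z hz hlt ha => Nat.find_min h hlt ⟨hz, ha⟩⟩

/-- Once the numbers below b have settled, the first alive number from b on has constant rank n.
When the largest n-symbol value ever attained from b on has appeared, that number carries it and
nothing can outbid it. -/
theorem exists_permanent_ge (b : ℕ) : ∃ y ≥ b, Permanent y := by
  classical
  obtain ⟨s₀, hs₀⟩ := exists_settled b
  have halive : ∀ s ≥ s₀, ∀ x < b, (Alive (conf s) x ↔ Alive (conf s₀) x) := fun s hs x hx =>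
    ⟨alive_anti hs, fun h => (hs₀ x hx).elim (fun h' => h' s) fun h' => absurd h h'⟩
  set n := rank (conf s₀) b with hn
  have hrank : ∀ s ≥ s₀, rank (conf s) b = n := fun s hs => by
    refine le_antisymm (rank_anti hs b) ?_
    rw [hn, rank, rank, Nat.count_eq_card_filter_range, Nat.count_eq_card_filter_range]
    refine Finset.card_le_card fun x hx => ?_
    simp only [Finset.mem_filter, Finset.mem_range] at hx ⊢
    exact ⟨hx.1, (halive s hs x hx.1).2 hx.2⟩
  let P : ℕ → Prop := fun v => ∃ s ≥ s₀, ∃ y ≥ b, Alive (conf s) y ∧ v ≤ stageVal s y n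
  have hP0 : P 0 := ⟨s₀, le_rfl, max b s₀, le_max_left _ _, alive_of_le (le_max_right _ _),
    Nat.zero_le _⟩
  have hbound : ∀ v, P v → v ≤ 4 ^ n := fun v ⟨s, _, y, _, _, hv⟩ =>
    hv.trans (stageVal_lt_pow s y n).le
  obtain ⟨s, hs, hex⟩ : P (Nat.findGreatest P (4 ^ n)) :=
    Nat.findGreatest_spec (Nat.zero_le _) hP0
  set M := Nat.findGreatest P (4 ^ n)
  have hmax : ∀ t ≥ s₀, ∀ y ≥ b, Alive (conf t) y → stageVal t y n ≤ M := fun t ht y hy ha =>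
    Nat.le_findGreatest (hbound _ ⟨t, ht, y, hy, ha, le_rfl⟩) ⟨t, ht, y, hy, ha, le_rfl⟩
  obtain ⟨y, hby, hy, hnext⟩ := exists_next s b
  have hrky : rank (conf s) y = n := by
    rw [← hrank s hs]
    refine le_antisymm ?_ (rank_mono _ hby)
    rw [rank, rank, Nat.count_eq_card_filter_range, Nat.count_eq_card_filter_range]
    refine Finset.card_le_card fun x hx => ?_
    simp only [Finset.mem_filter, Finset.mem_range] at hx ⊢
    refine ⟨?_, hx.2⟩
    by_contra! hbx
    exact hnext x hbx hx.1 hx.2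
  have hyM : M ≤ stageVal s y n := by
    obtain ⟨w, hbw, hw, hv⟩ := hex
    refine hv.trans (stageVal_le_of_alive hy hw ?_ hrky.ge)
    by_contra! hlt
    exact hnext w hbw hlt hw
  have hstay : ∀ t ≥ s, Alive (conf t) y := fun t ht => by
    induction t, ht using Nat.le_induction with
    | base => exact hy
    | succ t ht ih =>
      by_contra hdead
      have hyt : y ≤ t := by by_contra! h; exact hdead (alive_of_le h)
      rw [alive_succ_iff hyt, Survives, not_and, not_not] at hdead
      obtain ⟨w, hwt, hyw, hw, hlt⟩ := hdead ih
      have hrk : rank (conf t) y = n := le_antisymm ((rank_anti ht y).trans hrky.le)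
        ((hrank t (hs.trans ht)).ge.trans (rank_mono _ hby))
      rw [hrk, ← stateOf_succ hyt, ← stateOf_succ (by omega)] at hlt
      -- The killer's value passes to some u alive at the next stage, which would exceed the maximum
      -- M.
      obtain ⟨u, hwu, hu, huv⟩ := exists_alive_succ hw (hrk.ge.trans (rank_mono _ hyw.le))
      have h₁ := hmax (t + 1) (hs.trans (by omega)) u (by omega) hu
      have h₂ := stageVal_mono y n (show s ≤ t + 1 by omega)
      simp only [stageVal] at *
      omega
  exact ⟨y, hby, fun t => (le_total s t).elim (hstay t) fun h => alive_anti h hy⟩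

theorem exists_permanent_rank_ge (e : ℕ) :
    ∃ y, Permanent y ∧ ∀ s, e ≤ rank (conf s) y := by
  induction e with
  | zero =>
    obtain ⟨y, -, hy⟩ := exists_permanent_ge 0
    exact ⟨y, hy, fun _ => Nat.zero_le _⟩
  | succ e ih =>
    obtain ⟨y, hy, hr⟩ := ih
    obtain ⟨w, hw, hwp⟩ := exists_permanent_ge (y + 1)
    refine ⟨w, hwp, fun s => ?_⟩
    have h₁ : rank (conf s) (y + 1) = rank (conf s) y + 1 := by
      rw [rank, rank, Nat.count_succ, if_pos (hy s)]
    have h₂ := rank_mono (conf s) hw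
    have h₃ := hr s
    omega

theorem exists_stageVal_limit (x e : ℕ) : ∃ v s₀, ∀ s ≥ s₀, stageVal s x e = v := by
  classical
  let P : ℕ → Prop := fun v => ∃ s, v ≤ stageVal s x e
  obtain ⟨s₀, hs₀⟩ : P (Nat.findGreatest P (4 ^ e)) :=
    Nat.findGreatest_spec (Nat.zero_le _) ⟨0, Nat.zero_le _⟩
  exact ⟨_, s₀, fun s hs => le_antisymm
    (Nat.le_findGreatest (stageVal_lt_pow s x e).le ⟨s, le_rfl⟩)
    (hs₀.trans (stageVal_mono x e hs))⟩

/-- The data describing the eventual behaviour of the first `e` symbols: from `y₀` on, all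
permanent numbers eventually have the value `σ`, and `y₀` has it from stage `s₀` on. -/
structure IsLimit (e y₀ s₀ σ : ℕ) : Prop where
  permanent : Permanent y₀
  le_rank : ∀ s, e ≤ rank (conf s) y₀
  stageVal_eq : ∀ s ≥ s₀, stageVal s y₀ e = σ
  eventually_eq : ∀ y ≥ y₀, Permanent y → ∃ s₁, ∀ s ≥ s₁, stageVal s y e = σ

/-- Take σ least among the limit values of permanent numbers of rank at least e. Later permanent
numbers have no larger value by sortedness, and no smaller one by minimality. -/
theorem exists_isLimit (e : ℕ) : ∃ y₀ s₀ σ, IsLimit e y₀ s₀ σ := by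
  classical
  have hex : ∃ σ y, Permanent y ∧ (∀ s, e ≤ rank (conf s) y) ∧
      ∃ s₀, ∀ s ≥ s₀, stageVal s y e = σ := by
    obtain ⟨y, hy, hr⟩ := exists_permanent_rank_ge e
    obtain ⟨v, hv⟩ := exists_stageVal_limit y e
    exact ⟨v, y, hy, hr, hv⟩
  obtain ⟨y₀, hp, hr, s₀, hs₀⟩ := Nat.find_spec hex
  refine ⟨y₀, s₀, Nat.find hex, hp, hr, hs₀, fun y hy hyp => ?_⟩
  obtain ⟨v, s₁, hs₁⟩ := exists_stageVal_limit y e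
  have hle : Nat.find hex ≤ v :=
    Nat.find_min' hex ⟨y, hyp, fun s => (hr s).trans (rank_mono _ hy), s₁, hs₁⟩
  have h := stageVal_le_of_alive (hp (max s₀ s₁)) (hyp _) hy (hr _)
  rw [hs₀ _ (le_max_left _ _), hs₁ _ (le_max_right _ _)] at h
  exact ⟨s₁, fun s hs => (hs₁ s hs).trans (le_antisymm h hle)⟩

/-! ### The levels of the tower -/

/-- `y` is the first alive number from `x` on. -/
def IsNext (s x y : ℕ) : Prop :=
  x ≤ y ∧ Alive (conf s) y ∧ ∀ z < y, x ≤ z → ¬ Alive (conf s) z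

/-- The numbers that at each stage agree on the first `e` symbols with the next alive number. -/
def level (e : ℕ) : Set ℕ :=
  {x | ∀ s y, IsNext s x y → stageVal s x e = stageVal s y e}

theorem exists_isNext (s x : ℕ) : ∃ y, IsNext s x y := by
  obtain ⟨y, hxy, hy, h⟩ := exists_next s x
  exact ⟨y, hxy, hy, fun z hz hxz => h z hxz hz⟩

theorem IsNext.le_of_alive {s x y z : ℕ} (h : IsNext s x y) (hxz : x ≤ z)
    (hz : Alive (conf s) z) : y ≤ z := by
  by_contra! hlt
  exact h.2.2 z hlt hxz hz

theorem Permanent.mem_level {x : ℕ} (h : Permanent x) (e : ℕ) : x ∈ level e := fun s y hy => by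
  rw [le_antisymm hy.1 (hy.le_of_alive le_rfl (h s))]

theorem level_infinite (e : ℕ) : (level e).Infinite :=
  Set.infinite_of_forall_exists_gt fun b => by
    obtain ⟨y, hby, hy⟩ := exists_permanent_ge (b + 1)
    exact ⟨y, hy.mem_level e, hby⟩

theorem level_succ_subset (e : ℕ) : level (e + 1) ⊆ level e := fun x hx s y hy => by
  have h := hx s y hy
  exact le_antisymm (val_le_val_of_le e.le_succ h.le) (val_le_val_of_le e.le_succ h.ge)

/-- An alive number from `x` on has at least the state of `x`. -/
theorem exists_alive_stageVal_ge {e x : ℕ} (hr : ∀ s, e ≤ rank (conf s) x) (s : ℕ) :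
    ∃ y ≥ x, Alive (conf s) y ∧ stageVal s x e ≤ stageVal s y e := by
  induction s with
  | zero => exact ⟨x, le_rfl, alive_of_le (Nat.zero_le _), le_rfl⟩
  | succ s ih =>
    by_cases h : Alive (conf s) x
    · exact exists_alive_succ h (hr s)
    obtain ⟨y, hxy, hy, hv⟩ := ih
    obtain ⟨w, hyw, hw, hv'⟩ := exists_alive_succ hy ((hr s).trans (rank_mono _ hxy))
    refine ⟨w, hxy.trans hyw, hw, ?_⟩
    rw [stageVal_eq_of_not_alive s.le_succ h]
    exact hv.trans ((stageVal_le_succ s y e).trans hv')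

section IsLimit

variable {e y₀ s₀ σ x : ℕ}

/-- Even a dead x is dominated by an alive number from x on, which sortedness places below y₀. -/
theorem IsLimit.stageVal_le (h : IsLimit e y₀ s₀ σ) (hx : y₀ ≤ x) {s : ℕ} (hs : s₀ ≤ s) :
    stageVal s x e ≤ σ := by
  obtain ⟨y, hxy, hy, hv⟩ :=
    exists_alive_stageVal_ge (fun s => (h.le_rank s).trans (rank_mono _ hx)) s
  rw [← h.stageVal_eq s hs]
  exact hv.trans (stageVal_le_of_alive (h.permanent s) hy (hx.trans hxy) (h.le_rank s))

/-- Trades the universal definition of a level for an existential one, which gives enumerability of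
the level itself. -/
theorem IsLimit.mem_level_iff (h : IsLimit e y₀ s₀ σ) (hx : y₀ ≤ x) (hxs : s₀ ≤ x) :
    x ∈ level e ↔ ∃ s ≥ s₀, stageVal s x e = σ := by
  have hr : ∀ s, e ≤ rank (conf s) x := fun s => (h.le_rank s).trans (rank_mono _ hx)
  constructor
  · intro hmem
    obtain ⟨y, hxy, hy⟩ := exists_permanent_ge x
    obtain ⟨s₁, hs₁⟩ := h.eventually_eq y (hx.trans hxy) hy
    obtain ⟨w, hw⟩ := exists_isNext (max s₀ s₁) x
    refine ⟨max s₀ s₁, le_max_left _ _, ?_⟩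
    -- The value of w is squeezed between that of the permanent y and the bound σ.
    rw [hmem _ w hw]
    refine le_antisymm (h.stageVal_le (hx.trans hw.1) (le_max_left _ _)) ?_
    rw [← hs₁ _ (le_max_right s₀ s₁)]
    exact stageVal_le_of_alive hw.2.1 (hy _) (hw.le_of_alive hxy (hy _))
      ((hr _).trans (rank_mono _ hw.1))
  · rintro ⟨s, hs, hσ⟩ t w hw
    by_cases ha : Alive (conf t) x
    · rw [le_antisymm hw.1 (hw.le_of_alive le_rfl ha)]
    have ht : s₀ ≤ t := by
      by_contra! ht
      exact ha (alive_of_le (by omega))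
    have hxt : stageVal t x e = σ := by
      refine le_antisymm (h.stageVal_le hx ht) ?_
      -- If x died before reaching σ it could never reach it, so a dead x already has value σ.
      rcases le_total s t with hst | hts
      · exact hσ ▸ stageVal_mono x e hst
      · rw [← hσ, stageVal_eq_of_not_alive hts ha]
    obtain ⟨y, hxy, hy, hv⟩ := exists_alive_stageVal_ge hr t
    refine le_antisymm (hv.trans (stageVal_le_of_alive hw.2.1 hy (hw.le_of_alive hxy hy)
      ((hr _).trans (rank_mono _ hw.1)))) ?_
    rw [hxt]
    exact h.stageVal_le (hx.trans hw.1) ht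

end IsLimit

/-! ### Computability of the levels -/

theorem primrec_stageVal : Primrec fun p : ℕ × ℕ × ℕ => stageVal p.1 p.2.1 p.2.2 :=
  primrec_val.comp
    (primrec_stateOf.comp (primrec_config.comp Primrec.fst) (Primrec.fst.comp Primrec.snd))
    (Primrec.snd.comp Primrec.snd)

theorem primrecPred_isNext : PrimrecPred fun p : ℕ × ℕ × ℕ => IsNext p.1 p.2.1 p.2.2 := by
  have hC : Primrec fun p : ℕ × ℕ × ℕ => conf p.1 := primrec_config.comp Primrec.fst
  have hx : Primrec fun p : ℕ × ℕ × ℕ => p.2.1 := Primrec.fst.comp Primrec.snd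
  have hy : Primrec fun p : ℕ × ℕ × ℕ => p.2.2 := Primrec.snd.comp Primrec.snd
  refine (Primrec.nat_le.comp hx hy).and ((primrecRel_alive.comp hC hy).and
    (primrecPred_forall_lt hy ?_))
  have h : PrimrecPred fun q : (ℕ × ℕ × ℕ) × ℕ => ¬ q.1.2.1 ≤ q.2 ∨ ¬ Alive (conf q.1.1) q.2 :=
    (Primrec.nat_le.comp (hx.comp Primrec.fst) Primrec.snd).not.or
      (primrecRel_alive.comp (hC.comp Primrec.fst) Primrec.snd).not
  exact PrimrecPred.of_eq h fun q => imp_iff_not_or.symm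

/-- Failure is witnessed by one stage and one next alive number. The functions f and g allow both a
fixed level and the whole set F. -/
theorem rePred_notMem_level {f g : ℕ → ℕ} (hf : Primrec f) (hg : Primrec g) :
    REPred fun n => f n ∉ level (g n) := by
  have hs : Primrec fun q : ℕ × ℕ => q.2.unpair.1 :=
    Primrec.fst.comp (Primrec.unpair.comp Primrec.snd)
  have hy : Primrec fun q : ℕ × ℕ => q.2.unpair.2 :=
    Primrec.snd.comp (Primrec.unpair.comp Primrec.snd)
  have hx : Primrec fun q : ℕ × ℕ => f q.1 := hf.comp Primrec.fst
  have he : Primrec fun q : ℕ × ℕ => g q.1 := hg.comp Primrec.fst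
  have h : PrimrecRel fun n k : ℕ => IsNext k.unpair.1 (f n) k.unpair.2 ∧
      ¬ stageVal k.unpair.1 (f n) (g n) = stageVal k.unpair.1 k.unpair.2 (g n) :=
    (primrecPred_isNext.comp (hs.pair (hx.pair hy))).and
      (Primrec.eq.comp (primrec_stageVal.comp (hs.pair (hx.pair he)))
        (primrec_stageVal.comp (hs.pair (hy.pair he)))).not
  refine (rePred_exists h).of_eq fun n => ?_
  simp only [level, Set.mem_ofPred_eq, not_forall, exists_prop]
  constructor
  · rintro ⟨k, hk⟩
    exact ⟨_, _, hk⟩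
  · rintro ⟨s, y, hsy⟩
    exact ⟨Nat.pair s y, by simpa using hsy⟩

theorem primrecPred_mem_finite {S : Set ℕ} (hS : S.Finite) : PrimrecPred fun x => x ∈ S := by
  refine ((PrimrecRel.exists_mem_list (Primrec.eq (α := ℕ))).comp
    (Primrec.const hS.toFinset.toList) Primrec.id).of_eq fun x => ?_
  simp

theorem level_isComputableSet (e : ℕ) : IsComputableSet (level e) := by
  obtain ⟨y₀, s₀, σ, h⟩ := exists_isLimit e
  refine ComputablePred.computable_iff_re_compl_re'.2
    ⟨?_, rePred_notMem_level Primrec.id (Primrec.const e)⟩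
  let S : Set ℕ := {x | x ∈ level e ∧ x < max y₀ s₀}
  have hS : S.Finite := (Set.finite_lt_nat (max y₀ s₀)).subset fun x hx => hx.2
  have hR : PrimrecRel fun x s : ℕ =>
      x ∈ S ∨ (max y₀ s₀ ≤ x ∧ s₀ ≤ s ∧ stageVal s x e = σ) :=
    ((primrecPred_mem_finite hS).comp Primrec.fst).or
      ((Primrec.nat_le.comp (Primrec.const _) Primrec.fst).and
        ((Primrec.nat_le.comp (Primrec.const _) Primrec.snd).and
          (Primrec.eq.comp
            (primrec_stageVal.comp
              (Primrec.snd.pair (Primrec.fst.pair (Primrec.const e)))) (Primrec.const _))))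
  refine (rePred_exists hR).of_eq fun x => ?_
  rcases lt_or_ge x (max y₀ s₀) with hx | hx
  · constructor
    · rintro ⟨s, hs | hs⟩
      · exact hs.1
      · exact absurd hs.1 (by omega)
    · exact fun hmem => ⟨0, Or.inl ⟨hmem, hx⟩⟩
  · rw [h.mem_level_iff (le_of_max_le_left hx) (le_of_max_le_right hx)]
    constructor
    · rintro ⟨s, hs | hs⟩
      · exact absurd hs.2 (by omega)
      · exact ⟨s, hs.2⟩
    · rintro ⟨s, hs⟩
      exact ⟨s, Or.inr ⟨hx, hs⟩⟩

/-! ### Strictness of the tower -/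

section Limits

variable {e y₀ s₀ σ y₁ s₁ τ : ℕ}

/-- Eventually, the `e`-th symbol of permanent numbers is not `0`. -/
theorem IsLimit.lt_limit_succ (h : IsLimit e y₀ s₀ σ) (h' : IsLimit (e + 1) y₁ s₁ τ) :
    4 * σ < τ := by
  obtain ⟨z, hz, hzp⟩ := exists_permanent_ge (max y₀ y₁)
  obtain ⟨y, hy, hyp⟩ := exists_permanent_ge (z + 1)
  obtain ⟨a, ha⟩ := h.eventually_eq z (by omega) hzp
  obtain ⟨b, hb⟩ := h'.eventually_eq z (by omega) hzp
  obtain ⟨c, hc⟩ := h.eventually_eq y (by omega) hyp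
  obtain ⟨d, hd⟩ := h'.eventually_eq y (by omega) hyp
  -- A stage devoted to symbol e, late enough that all four values are final.
  set s := Nat.pair e (a + b + c + d + y) with hs
  have hle : a + b + c + d + y ≤ s := Nat.right_le_pair _ _
  have hi : s.unpair.1 = e := by simp [hs]
  have ha' := ha s (by omega)
  have hb' := hb s (by omega)
  have hc' := hc s (by omega)
  have hd' := hd s (by omega)
  have hd'' := hd (s + 1) (by omega)
  unfold stageVal at *
  rw [val_succ] at hb' hd'
  by_contra! hlt
  -- Otherwise z and y both show 0 at e, so z is a witness and this stage changes the supposedly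
  -- final value of y.
  have hwit : HasWitness (conf s) e y :=
    ⟨z, by omega, hzp s, by omega, by omega,
      (h'.le_rank s).trans (rank_mono _ (show y₁ ≤ z by omega))⟩
  rw [stateOf_succ (by omega), newState, hi, if_pos ⟨hyp s, by omega, hwit⟩, val_succ,
    val_setSym_of_le _ _ le_rfl, sym_setSym_self _ _ (by omega)] at hd''
  omega

/-- A number whose `e`-th symbol becomes nonzero leaves behind a killed number in which that
symbol is `0`. -/
theorem IsLimit.exists_killed (h : IsLimit e y₀ s₀ σ) {y s : ℕ} (hy : Permanent y)
    (hy₀ : y₀ ≤ y) (hs : s₀ ≤ s) (hys : y ≤ s) (hlow : stageVal s y (e + 1) ≤ 4 * σ)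
    (hhigh : 4 * σ < stageVal (s + 1) y (e + 1)) :
    ∃ z, Alive (conf s) z ∧ ¬ Alive (conf (s + 1)) z ∧ stageVal (s + 1) z e = σ ∧
      stageVal (s + 1) z (e + 1) = 4 * σ := by
  classical
  have hb := h.stageVal_le hy₀ (Nat.le_succ_of_le hs)
  have hhigh' := hhigh
  have hmono := stageVal_le_succ s y e
  unfold stageVal at *
  rw [val_succ] at hlow hhigh
  rw [stateOf_succ hys] at hhigh hb hmono
  have hsymle := sym_le (newState (conf s) s y) e
  -- Treating an earlier index would reset symbol e to 0, and a later one would leave it alone; so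
  -- symbol e itself just rose from 0, by the witness clause.
  have hkey : s.unpair.1 = e ∧ HasWitness (conf s) e y ∧ val (stateOf (conf s) y) e = σ := by
    have hother : ∀ v, newState (conf s) s y = setSym (stateOf (conf s) y) s.unpair.1 v →
        s.unpair.1 = e ∧ val (stateOf (conf s) y) e = σ := fun v hv => by
      rcases lt_trichotomy s.unpair.1 e with hlt | heq | hgt
      · rw [hv, sym_setSym_of_gt _ _ hlt, ← hv] at hhigh
        omega
      · refine ⟨heq, ?_⟩
        have : val (newState (conf s) s y) e = val (stateOf (conf s) y) e := by
          rw [hv, heq, val_setSym_of_le _ _ le_rfl]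
        omega
      · rw [hv, val_setSym_of_le _ _ hgt.le, sym_setSym_of_lt _ _ hgt] at hhigh
        omega
    rcases newState_cases (conf s) s y with hc | ⟨-, ⟨-, hw, hc⟩ | ⟨v, -, h₁, -, hc⟩⟩
    · rw [hc] at hhigh
      omega
    · obtain ⟨h₁, h₂⟩ := hother _ hc
      exact ⟨h₁, h₁ ▸ hw, h₂⟩
    · obtain ⟨h₂, h₃⟩ := hother _ hc
      rw [h₂] at h₁
      omega
  obtain ⟨hi, hw, hσ⟩ := hkey
  -- The least witness has no witness of its own, so its state does not change at this stage.
  obtain ⟨hzy, hz, hzv, hz0, hzr⟩ := Nat.find_spec hw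
  set z := Nat.find hw
  have hmin : ¬ HasWitness (conf s) e z := fun ⟨u, hu, hua, huv, hu'⟩ =>
    Nat.find_min hw hu ⟨hu.trans hzy, hua, huv.trans hzv, hu'⟩
  have hnew : newState (conf s) s z = stateOf (conf s) z := by
    rcases newState_cases (conf s) s z with hc | ⟨-, ⟨-, hw, -⟩ | ⟨v, -, h₁, -, -⟩⟩
    · exact hc
    · exact absurd (hi ▸ hw) hmin
    · rw [hi] at h₁
      omega
  have hval : val (newState (conf s) s z) (e + 1) = 4 * σ := by
    rw [hnew, val_succ]
    omega
  have hzs : z ≤ s := by omega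
  refine ⟨z, hz, fun hz' => ((alive_succ_iff hzs).1 hz').2
    ⟨y, by omega, hzy, hy s, val_lt_val_of_le (Nat.succ_le_of_lt hzr) ?_⟩, ?_, ?_⟩
  · rw [Nat.succ_eq_add_one, hval, ← stateOf_succ hys]
    exact hhigh'
  · rw [stateOf_succ hzs, hnew]
    omega
  · rw [stateOf_succ hzs, hval]

end Limits

theorem level_diff_infinite (e : ℕ) : (level e \ level (e + 1)).Infinite := by
  classical
  obtain ⟨y₀, s₀, σ, h⟩ := exists_isLimit e
  obtain ⟨y₁, s₁, τ, h'⟩ := exists_isLimit (e + 1)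
  have hτ := h.lt_limit_succ h'
  refine Set.infinite_of_forall_exists_gt fun b => ?_
  set N := b + y₀ + s₀ + y₁ + s₁ with hN
  obtain ⟨t, ht⟩ := exists_settled (N + 1)
  -- The symbol of y can rise only at a stage s ≥ y ≥ t, when all numbers up to N have settled; the
  -- number killed then exceeds N.
  obtain ⟨y, hy, hyp⟩ := exists_permanent_ge (N + t)
  obtain ⟨u, hu⟩ := h'.eventually_eq y (by omega) hyp
  have hex : ∃ s, 4 * σ < stageVal s y (e + 1) := ⟨u, by rw [hu u le_rfl]; exact hτ⟩
  have hys : y < Nat.find hex := by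
    by_contra! hle
    have := Nat.find_spec hex
    rw [stageVal_of_le hle] at this
    omega
  obtain ⟨s, hs⟩ : ∃ s, Nat.find hex = s + 1 := ⟨Nat.find hex - 1, by omega⟩
  obtain ⟨z, hz, hz', hze, hze'⟩ := h.exists_killed hyp (by omega) (show s₀ ≤ s by omega)
    (by omega) (not_lt.1 (Nat.find_min hex (show s < Nat.find hex by omega)))
    (hs ▸ Nat.find_spec hex)
  have hNz : N < z := by
    by_contra! hle
    rcases ht z (by omega) with hp | hd
    · exact hz' (hp _)
    · exact hd (alive_anti (by omega) hz)
  refine ⟨z, ⟨(h.mem_level_iff (by omega) (by omega)).2 ⟨s + 1, by omega, hze⟩, ?_⟩, by omega⟩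
  rw [h'.mem_level_iff (by omega) (by omega)]
  rintro ⟨r, -, hr⟩
  -- By monotonicity before its death and freezing after it, z never exceeds 4σ, hence never reaches
  -- τ.
  rcases le_total r (s + 1) with hrs | hrs
  · have : stageVal r z (e + 1) ≤ stageVal (s + 1) z (e + 1) := stageVal_mono z (e + 1) hrs
    omega
  · rw [stageVal_eq_of_not_alive hrs hz'] at hr
    omega

/-! ### The levels decide all computable sets -/

/-- Symbols 2 and 3 are written only after a halting computation; treating another index preserves
them or resets them to 0. -/
theorem mem_eval_of_sym {s x i v : ℕ} (h : sym (stateOf (conf s) x) i = v + 2) :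
    v ∈ (Denumerable.ofNat Nat.Partrec.Code i).eval x := by
  induction s with
  | zero => rw [stateOf_of_le (Nat.zero_le _)] at h; simp [sym] at h
  | succ s ih =>
    rcases le_or_gt x s with hx | hx
    · have hset : ∀ w, w ≤ 3 → sym (setSym (stateOf (conf s) x) s.unpair.1 w) i = v + 2 →
          (s.unpair.1 = i ∧ w = v + 2) ∨ sym (stateOf (conf s) x) i = v + 2 := fun w hw hsym => by
        rcases lt_trichotomy s.unpair.1 i with hlt | heq | hgt
        · rw [sym_setSym_of_gt _ _ hlt] at hsym
          omega
        · rw [heq, sym_setSym_self _ _ hw] at hsym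
          exact Or.inl ⟨heq, hsym⟩
        · rw [sym_setSym_of_lt _ _ hgt] at hsym
          exact Or.inr hsym
      rw [stateOf_succ hx] at h
      rcases newState_cases (conf s) s x with hc | ⟨-, ⟨-, -, hc⟩ | ⟨w, hw, -, hrun, hc⟩⟩
      · exact ih (hc ▸ h)
      · rw [hc] at h
        rcases hset 1 (by omega) h with ⟨-, hv⟩ | h'
        · omega
        · exact ih h'
      · rw [hc] at h
        rcases hset (w + 2) (by omega) h with ⟨hi, hv⟩ | h'
        · obtain rfl : w = v := by omega
          rw [hi] at hrun
          exact Nat.Partrec.Code.evaln_sound hrun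
        · exact ih h'
    · rw [stateOf_of_le hx] at h
      simp [sym] at h

/-- If the `i`-th partial computable function is total with values `0` and `1`, then it is
almost constant on level `i + 1`. -/
theorem exists_level_eval {i : ℕ} {g : ℕ → ℕ}
    (hg : ∀ x, g x ∈ (Denumerable.ofNat Nat.Partrec.Code i).eval x) (hg1 : ∀ x, g x ≤ 1) :
    ∃ v N, ∀ x ∈ level (i + 1), N ≤ x → g x = v := by
  obtain ⟨y₀, s₀, σ, h⟩ := exists_isLimit i
  obtain ⟨y₁, s₁, τ, h'⟩ := exists_isLimit (i + 1)
  have hτ := h.lt_limit_succ h'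
  have hcode : ∀ {s x v}, sym (stateOf (conf s) x) i = v + 2 → g x = v := fun hsym =>
    Part.mem_unique (hg _) (mem_eval_of_sym hsym)
  -- the `i`-th symbol of a permanent number is eventually at least `2`
  have hτ2 : 4 * σ + 2 ≤ τ := by
    obtain ⟨y, hy, hyp⟩ := exists_permanent_ge (max y₀ y₁)
    obtain ⟨a, ha⟩ := h.eventually_eq y (by omega) hyp
    obtain ⟨b, hb⟩ := h'.eventually_eq y (by omega) hyp
    obtain ⟨k, hk⟩ := Nat.Partrec.Code.evaln_complete.1 (hg y)
    -- A stage for index i at which the values are final and the computation on y has halted: a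
    -- symbol 1 would be raised.
    set s := Nat.pair i (a + b + k + y) with hs
    have hle : a + b + k + y ≤ s := Nat.right_le_pair _ _
    have hi : s.unpair.1 = i := by simp [hs]
    have hrun : run s i y = some (g y) :=
      Nat.Partrec.Code.evaln_mono (show k ≤ s by omega) hk
    have ha' := ha s (by omega)
    have hb' := hb s (by omega)
    have hb'' := hb (s + 1) (by omega)
    unfold stageVal at *
    rw [val_succ] at hb'
    by_contra! hlt
    have hsym : sym (stateOf (conf s) y) i = 1 := by omega
    have hset : ∀ v, v ≤ 3 → 1 < v →
        newState (conf s) s y ≠ setSym (stateOf (conf s) y) i v := fun v hv hv1 hc => by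
      rw [stateOf_succ (by omega), hc, val_succ, val_setSym_of_le _ _ le_rfl,
        sym_setSym_self _ _ hv] at hb''
      omega
    have h0 : ¬ (Alive (conf s) y ∧ sym (stateOf (conf s) y) i = 0 ∧
        HasWitness (conf s) i y) := fun hc => by omega
    rcases Nat.le_one_iff_eq_zero_or_eq_one.1 (hg1 y) with hv | hv
    · rw [hv] at hrun
      exact hset 2 (by omega) (by omega) (by
        rw [newState, hi, if_neg h0, if_pos ⟨hyp s, hsym, hrun⟩])
    · rw [hv] at hrun
      exact hset 3 (by omega) (by omega) (by
        rw [newState, hi, if_neg h0, if_neg (by rw [hrun]; simp), if_pos ⟨hyp s, hsym, hrun⟩])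
  -- The last base-4 digit of τ is τ - 4σ, which encodes the output plus 2.
  refine ⟨τ - (4 * σ + 2), max (max y₀ s₀) (max y₁ s₁), fun x hx hN => ?_⟩
  obtain ⟨s, hs, hsx⟩ := (h'.mem_level_iff (by omega) (by omega)).1 hx
  obtain ⟨r, hr, hrx⟩ := (h.mem_level_iff (by omega) (by omega)).1 (level_succ_subset i hx)
  have h₁ : stageVal (max r s) x i = σ := le_antisymm (h.stageVal_le (by omega) (by omega))
    (hrx ▸ stageVal_mono x i (le_max_left r s))
  have h₂ : stageVal (max r s) x (i + 1) = τ :=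
    le_antisymm (h'.stageVal_le (by omega) (by omega))
      (hsx ▸ stageVal_mono x (i + 1) (le_max_right r s))
  refine hcode (s := max r s) ?_
  unfold stageVal at h₁ h₂
  rw [val_succ] at h₂
  omega

theorem level_decides {R : Set ℕ} (hR : IsComputableSet R) :
    ∃ n, AlmostSubset (level n) Rᶜ ∨ AlmostSubset (level n) R := by
  obtain ⟨f, hf, hfR⟩ := ComputablePred.computable_iff.1 hR
  have hmem : ∀ x, x ∈ R ↔ f x = true := fun x => iff_of_eq (congrFun hfR x)
  have hg : Computable fun x => (f x).toNat := (Primrec.dom_bool Bool.toNat).to_comp.comp hf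
  obtain ⟨c, hc⟩ := Nat.Partrec.Code.exists_code.1 (Partrec.nat_iff.1 hg.partrec)
  obtain ⟨v, N, hv⟩ := exists_level_eval (i := Encodable.encode c) (g := fun x => (f x).toNat)
    (fun x => by rw [Denumerable.ofNat_encode, hc]; simp) fun x => Bool.toNat_le _
  refine ⟨Encodable.encode c + 1, ?_⟩
  by_cases h1 : v = 1
  · refine Or.inr ((Set.finite_lt_nat N).subset fun x hx => ?_)
    by_contra hN
    refine hx.2 ((hmem x).2 ?_)
    have := hv x hx.1 (not_lt.1 hN)
    simpa [h1] using this
  · refine Or.inl ((Set.finite_lt_nat N).subset fun x hx => ?_)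
    by_contra hN
    refine hx.2 fun hxR => h1 ?_
    have := hv x hx.1 (not_lt.1 hN)
    simpa [(hmem x).1 hxR] using this.symm

end TowerConstruction

open TowerConstruction

theorem mainTheorem5 : ∃ F : Set ℕ, IsCoCE F ∧ IsUltrafilterBase F := by
  have hcol : ∀ n, column {p | p.unpair.1 ∈ level p.unpair.2} n = level n := fun n => by
    ext x
    simp [column]
  refine ⟨{p | p.unpair.1 ∈ level p.unpair.2},
    rePred_notMem_level (Primrec.fst.comp Primrec.unpair) (Primrec.snd.comp Primrec.unpair),
    ⟨fun n => ?_, fun n => ?_⟩, fun R hR => ?_⟩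
  · rw [hcol]
    exact ⟨level_infinite n, level_isComputableSet n⟩
  -- The levels are nested outright, not just up to finite sets.
  · rw [hcol, hcol, AlmostSubset, Set.sdiff_eq_empty.2 (level_succ_subset n)]
    exact ⟨Set.finite_empty, level_diff_infinite n⟩
  · simp only [hcol]
    exact level_decides hR
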